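/- For a real number $H$ let $\Gamma(H)$ be the number of pairs of positive integers $x, y \le H$ for which both $x^2+y^2+1$ and $x^2+y^2+2$ are square-free, that is, $$\Gamma(H)=\sum_{1\le x,y\le H}\mu^2(x^2+y^2+1)\,\mu^2(x^2+y^2+2).$$ For positive integers $q_1,q_2$ let $\lambda(q_1,q_2)$ be the number of pairs of integers $1\le x,y\le q_1q_2$ with $x^2+y^2+1\equiv 0 \pmod{q_1}$ and $x^2+y^2+2\equiv 0\pmod{q_2}$. Then the product over all primes $$\sigma=\prod_p\left(1-\frac{\lambda(p^2,1)+\lambda(1,p^2)}{p^4}\right)$$ converges unconditionally, and for every $\varepsilon>0$, $$\Gamma(H)=\sigma H^2+O\left(H^{8/5+\varepsilon}\right)\qquad (H\to\infty),$$ where the implied constant depends only on $\varepsilon$. As a consequence, there are infinitely many positive integers $n$ of the form $n=x^2+y^2+1$ with positive integers $x,y$ such that $n=x^2+y^2+1$ and $n+1=x^2+y^2+2$ are both square-free. -/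

import Mathlib

/-- `Γ(H)`: the number of pairs of positive integers `x, y ≤ H` such that both `x² + y² + 1` and
`x² + y² + 2` are square-free. Here `H` is a real number. -/
noncomputable def squarefreePairCount (H : ℝ) : ℕ :=
  ((Finset.Icc 1 ⌊H⌋₊ ×ˢ Finset.Icc 1 ⌊H⌋₊).filter fun v : ℕ × ℕ =>
    Squarefree (v.1 ^ 2 + v.2 ^ 2 + 1) ∧ Squarefree (v.1 ^ 2 + v.2 ^ 2 + 2)).card

/-- `λ(q₁, q₂)`: the number of pairs `1 ≤ x, y ≤ q₁ q₂` such that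
`x² + y² + 1 ≡ 0 (mod q₁)` and `x² + y² + 2 ≡ 0 (mod q₂)`. -/
def solutionCount (q₁ q₂ : ℕ) : ℕ :=
  ((Finset.Icc 1 (q₁ * q₂) ×ˢ Finset.Icc 1 (q₁ * q₂)).filter fun v : ℕ × ℕ =>
    v.1 ^ 2 + v.2 ^ 2 + 1 ≡ 0 [MOD q₁] ∧ v.1 ^ 2 + v.2 ^ 2 + 2 ≡ 0 [MOD q₂]).card

/-- The factor `1 - (λ(p², 1) + λ(1, p²)) / p⁴` at the prime `p`. -/
noncomputable def sigmaFactor (p : Nat.Primes) : ℝ :=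
  1 - ((solutionCount ((p : ℕ) ^ 2) 1 : ℝ) + (solutionCount 1 ((p : ℕ) ^ 2) : ℝ)) /
    ((p : ℕ) : ℝ) ^ 4

/-- The constant `σ`, the product of the factors over all primes. -/
noncomputable def sigmaConst : ℝ := ∏' p : Nat.Primes, sigmaFactor p

/-!
The idea is to detect square-free values through the single product
`F(x, y) = (x² + y² + 1)(x² + y² + 2)`: its factors are consecutive, hence coprime, so both are
square-free exactly when `F` is, and the indicator is `∑ μ(d)` over `d² ∣ F` (`sum_moebius_sq_dvd`).
With `X = ⌊H⌋`, the sum is cut at `d ≤ √X`, and elementary counting already gives the exponent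
`3 / 2 + ε`, which is stronger than `8 / 5 + ε`.

For `d ≤ √X`, the square of side `X` is cut into residue classes modulo `d²`, each containing
`X² / d⁴ + O(X / d² + 1)` points (`abs_boxCount_sub_le`). The number `ρ(d²)` of zeros of `F` modulo
`d²` is `≪ d ^ (2 + ε)` (`exists_rootCount_sq_le`), so the main terms are
`X² ∑_{d ≤ √X} μ(d) ρ(d²) / d⁴ + O(X ^ (3 / 2 + ε))`, and completing the series costs no more. As `ρ`
is multiplicative by the Chinese remainder theorem, the complete series is the Euler product `σ`
(`hasProd_sigmaFactor`).

For `d > √X`, write `d = a b` with `a² ∣ n + 1` and `b² ∣ n + 2`, where `n = x² + y²`. After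
replacing `(a, b)` by `(a, 1)` or `(1, b)` when `a b > 2 X`, one may assume `√X < a b ≤ 2 X`; such
`n ≤ 2 X²` lie in one class modulo `(a b)²`, so altogether there are `O(X ^ (3 / 2 + ε))` of them
(`card_largeSquareDivisorSet_le`). Each `n` is a sum of two squares in `≪ n ^ ε` ways
(`exists_card_sumTwoSquaresReps_le_rpow`), which bounds the number of points `(x, y)`.

Finally every factor of `σ` is positive, so `σ > 0` (`sigmaConst_pos`), the count is unbounded, and
infinitely many `n` occur.
-/

open Finset

/-! ### The divisor bound -/

lemma succ_le_mul_rpow {ε : ℝ} (hε : 0 < ε) {p : ℕ} (hp : 2 ≤ p) (e : ℕ) :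
    (e + 1 : ℝ) ≤ max 1 (1 / (ε * Real.log 2)) * ((p : ℝ) ^ ε) ^ e := by
  have hlog : 0 < Real.log 2 := Real.log_pos (by norm_num)
  have hK1 : (1 : ℝ) ≤ max 1 (1 / (ε * Real.log 2)) := le_max_left _ _
  have hK2 : 1 ≤ max 1 (1 / (ε * Real.log 2)) * (ε * Real.log 2) := by
    calc (1 : ℝ) = 1 / (ε * Real.log 2) * (ε * Real.log 2) := by field_simp
      _ ≤ _ := by gcongr; exact le_max_right _ _
  have h2 : 1 + e * (ε * Real.log 2) ≤ ((2 : ℝ) ^ ε) ^ e := by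
    rw [← Real.rpow_natCast, ← Real.rpow_mul (by norm_num), Real.rpow_def_of_pos (by norm_num)]
    have := Real.add_one_le_exp (Real.log 2 * (ε * e))
    linarith
  have h3 : ((2 : ℝ) ^ ε) ^ e ≤ ((p : ℝ) ^ ε) ^ e := by
    gcongr
    exact_mod_cast hp
  calc (e + 1 : ℝ) ≤ max 1 (1 / (ε * Real.log 2)) * (1 + e * (ε * Real.log 2)) := by
        have : (0 : ℝ) ≤ e := by positivity
        nlinarith
    _ ≤ _ := by gcongr; exact h2.trans h3

/-- The divisor bound `τ(n) ≪ n ^ ε`. The factor `e + 1` of `τ` at a prime power `p ^ e` is at most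
`p ^ (ε e)` once `p ^ ε ≥ 2`, so only boundedly many primes contribute to the constant. -/
theorem exists_card_divisors_le_rpow {ε : ℝ} (hε : 0 < ε) :
    ∃ C : ℝ, 1 ≤ C ∧ ∀ n : ℕ, n ≠ 0 → (n.divisors.card : ℝ) ≤ C * (n : ℝ) ^ ε := by
  set K : ℝ := max 1 (1 / (ε * Real.log 2)) with hK
  have hK1 : (1 : ℝ) ≤ K := le_max_left _ _
  obtain ⟨P, hP⟩ := exists_nat_gt ((2 : ℝ) ^ (1 / ε))
  refine ⟨K ^ P, one_le_pow₀ hK1, fun n hn => ?_⟩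
  have hn' : ((n : ℝ)) ^ ε = ∏ p ∈ n.primeFactors, ((p : ℝ) ^ ε) ^ n.factorization p := by
    conv_lhs => rw [← Nat.prod_factorization_pow_eq_self hn, Finsupp.prod,
      Nat.support_factorization]
    push_cast
    rw [← Real.finsetProd_rpow _ _ (fun i _ => by positivity)]
    refine Finset.prod_congr rfl fun p _ => ?_
    rw [← Real.rpow_natCast, ← Real.rpow_natCast, ← Real.rpow_mul (by positivity),
      ← Real.rpow_mul (by positivity), mul_comm]
  rw [Nat.card_divisors hn, hn']
  push_cast
  calc ∏ p ∈ n.primeFactors, ((n.factorization p : ℝ) + 1)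
      ≤ ∏ p ∈ n.primeFactors, ((if p < P then K else 1) * ((p : ℝ) ^ ε) ^ n.factorization p) := by
        refine Finset.prod_le_prod (fun _ _ => by positivity) fun p hp => ?_
        have hp2 := (Nat.prime_of_mem_primeFactors hp).two_le
        split_ifs with h
        · exact succ_le_mul_rpow hε hp2 _
        · rw [one_mul]
          have h2 : (2 : ℝ) ≤ (p : ℝ) ^ ε := by
            have : (2 : ℝ) ^ (1 / ε) ≤ p := hP.le.trans (by exact_mod_cast not_lt.1 h)
            calc (2 : ℝ) = ((2 : ℝ) ^ (1 / ε)) ^ ε := by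
                  rw [← Real.rpow_mul (by norm_num), one_div_mul_cancel hε.ne', Real.rpow_one]
              _ ≤ _ := by gcongr
          calc (n.factorization p : ℝ) + 1 ≤ 2 ^ n.factorization p := by
                exact_mod_cast Nat.lt_two_pow_self
            _ ≤ _ := by gcongr
    _ = (∏ p ∈ n.primeFactors, if p < P then K else 1) *
          ∏ p ∈ n.primeFactors, ((p : ℝ) ^ ε) ^ n.factorization p := Finset.prod_mul_distrib
    _ ≤ _ := by
        gcongr
        rw [Finset.prod_ite, Finset.prod_const, Finset.prod_const_one, mul_one]
        refine pow_le_pow_right₀ hK1 ?_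
        calc _ ≤ (range P).card := card_le_card fun p hp => by
              simpa using (Finset.mem_filter.1 hp).2
          _ = P := card_range P

/-! ### Representations as a sum of two squares -/

/-- Fix a coprime representation `n = x₀² + y₀²`. Any other coprime representation `n = x² + y²` is
determined by the divisor `gcd(n, x y₀ - x₀ y)` of `n`: since `n` divides
`(x y₀ - x₀ y) (x y₀ + x₀ y)`, this divisor says which part of `n` divides the first factor, and the
rest divides the second one, which fixes `x / y` modulo `n`. -/
lemma eq_of_gcd_cross_eq {n x y x' y' x₀ y₀ : ℕ}
    (hx : 0 < x) (hy : 0 < y) (hx' : 0 < x') (hy' : 0 < y')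
    (h : x ^ 2 + y ^ 2 = n) (h' : x' ^ 2 + y' ^ 2 = n) (h₀ : x₀ ^ 2 + y₀ ^ 2 = n)
    (hc : x.Coprime y) (hc' : x'.Coprime y') (hc₀ : x₀.Coprime y₀)
    (hg : Int.gcd n (x * y₀ - x₀ * y) = Int.gcd n (x' * y₀ - x₀ * y')) :
    x = x' ∧ y = y' := by
  have hn : 0 < n := by rw [← h]; positivity
  zify at h h' h₀
  have key : ∀ {u v : ℕ}, (u : ℤ) ^ 2 + (v : ℤ) ^ 2 = n → u.Coprime v → IsCoprime (v : ℤ) n := by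
    intro u v huv hcop
    have h1 : IsCoprime (v : ℤ) ((u : ℤ) ^ 2) :=
      (Nat.isCoprime_iff_coprime.2 hcop).symm.pow_right
    rw [← huv, show (u : ℤ) ^ 2 + (v : ℤ) ^ 2 = (u : ℤ) ^ 2 + v * v by ring]
    exact h1.add_mul_left_right v
  have hy₀n : IsCoprime (y₀ : ℤ) n := key h₀ hc₀
  have hxn : IsCoprime (x : ℤ) n := key (by rw [add_comm]; exact h) hc.symm
  set g : ℤ := ((Int.gcd n (x * y₀ - x₀ * y) : ℕ) : ℤ) with hgdef
  have hgn : g ∣ n := Int.gcd_dvd_left ..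
  have hg0 : g ≠ 0 := by
    intro h0; rw [h0, zero_dvd_iff] at hgn; exact_mod_cast hn.ne' (by exact_mod_cast hgn)
  obtain ⟨k, hk⟩ := hgn
  -- the complementary factor divides the conjugate cross term
  have conj : ∀ {u v : ℕ}, (u : ℤ) ^ 2 + (v : ℤ) ^ 2 = n →
      ((Int.gcd n (u * y₀ - x₀ * v) : ℕ) : ℤ) = g → k ∣ (u * y₀ + x₀ * v : ℤ) := by
    intro u v huv hgcd
    obtain ⟨m, hm⟩ : g ∣ (u * y₀ - x₀ * v : ℤ) := hgcd ▸ Int.gcd_dvd_right ..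
    have hkm : IsCoprime k m := by
      have e1 := Int.gcd_eq_gcd_ab (n : ℤ) (u * y₀ - x₀ * v)
      refine ⟨Int.gcdA n (u * y₀ - x₀ * v), Int.gcdB n (u * y₀ - x₀ * v), ?_⟩
      refine mul_left_cancel₀ hg0 ?_
      rw [hgcd] at e1
      linear_combination -e1 - Int.gcdA n (u * y₀ - x₀ * v) * hk - Int.gcdB n (u * y₀ - x₀ * v) * hm
    refine hkm.dvd_of_dvd_mul_left ((mul_dvd_mul_iff_left hg0).1 ?_)
    refine ⟨u ^ 2 - x₀ ^ 2, ?_⟩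
    rw [← hk]
    linear_combination (-(u * y₀ + x₀ * v : ℤ)) * hm - (x₀ : ℤ) ^ 2 * huv + (u : ℤ) ^ 2 * h₀
  have hk1 := conj h rfl
  have hk2 := conj h' (by rw [hgdef, hg])
  have hg1 : g ∣ (x * y₀ - x₀ * y : ℤ) := Int.gcd_dvd_right ..
  have hg2 : g ∣ (x' * y₀ - x₀ * y' : ℤ) := by
    rw [hgdef, hg]; exact Int.gcd_dvd_right ..
  have dvdg : g ∣ (x * y' - x' * y : ℤ) := by
    have : IsCoprime g (y₀ : ℤ) := (hy₀n.of_isCoprime_of_dvd_right ⟨k, hk⟩).symm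
    refine this.dvd_of_dvd_mul_left ?_
    convert (hg1.mul_right (y' : ℤ)).sub (hg2.mul_right (y : ℤ)) using 1
    ring
  have dvdk : k ∣ (x * y' - x' * y : ℤ) := by
    have : IsCoprime k (y₀ : ℤ) :=
      (hy₀n.of_isCoprime_of_dvd_right ⟨g, by rw [hk, mul_comm]⟩).symm
    refine this.dvd_of_dvd_mul_left ?_
    convert (hk1.mul_right (y' : ℤ)).sub (hk2.mul_right (y : ℤ)) using 1
    ring
  -- the two factors of `n` share only divisors of `2`, and `4 ∤ n`
  have hcop : IsCoprime g k := by
    rw [Int.isCoprime_iff_gcd_eq_one]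
    set e : ℤ := ((Int.gcd g k : ℕ) : ℤ) with he
    have heg : e ∣ g := Int.gcd_dvd_left ..
    have hek : e ∣ k := Int.gcd_dvd_right ..
    have hen : e * e ∣ n := hk ▸ mul_dvd_mul heg hek
    have hen1 : e ∣ n := (Dvd.intro _ rfl).trans hen
    have h2 : e ∣ 2 := by
      have h1 : e ∣ (x * y₀ : ℤ) * 2 := by
        have h12 := dvd_add (heg.trans hg1) (hek.trans hk1)
        rwa [show (x * y₀ - x₀ * y + (x * y₀ + x₀ * y) : ℤ) = x * y₀ * 2 by ring] at h12
      exact ((hxn.mul_left hy₀n).of_isCoprime_of_dvd_right hen1).symm.dvd_of_dvd_mul_left h1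
    have h2' : Int.gcd g k ∣ 2 := Int.natCast_dvd_natCast.1 h2
    rcases (Nat.dvd_prime Nat.prime_two).1 h2' with h1 | h1
    · exact h1
    · exfalso
      have h4 : (4 : ℤ) ∣ n := by rw [he, h1] at hen; exact_mod_cast hen
      have hx2 : ¬ (2 : ℤ) ∣ x := by
        intro h2x
        have := hxn.isUnit_of_dvd' h2x ((by norm_num : (2 : ℤ) ∣ 4).trans h4)
        rw [Int.isUnit_iff] at this; omega
      have hy2 : ¬ (2 : ℤ) ∣ y := by
        intro h2y
        have := (key h hc).isUnit_of_dvd' h2y ((by norm_num : (2 : ℤ) ∣ 4).trans h4)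
        rw [Int.isUnit_iff] at this; omega
      have a1 : (x : ℤ) ^ 2 % 4 = 1 := Int.sq_mod_four_eq_one_of_odd (by
        rw [← Int.not_even_iff_odd, even_iff_two_dvd]; exact hx2)
      have a2 : (y : ℤ) ^ 2 % 4 = 1 := Int.sq_mod_four_eq_one_of_odd (by
        rw [← Int.not_even_iff_odd, even_iff_two_dvd]; exact hy2)
      omega
  have hdvd : (n : ℤ) ∣ (x * y' - x' * y : ℤ) := hk ▸ hcop.mul_dvd dvdg dvdk
  -- both products lie strictly between `0` and `n`
  have hzero : (x * y' - x' * y : ℤ) = 0 := by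
    refine Int.eq_zero_of_abs_lt_dvd hdvd ?_
    have hx1 : (0 : ℤ) < x := by exact_mod_cast hx
    have hx2 : (0 : ℤ) < x' := by exact_mod_cast hx'
    have hx3 : (0 : ℤ) < y := by exact_mod_cast hy
    have hx4 : (0 : ℤ) < y' := by exact_mod_cast hy'
    rw [abs_lt]
    constructor <;> nlinarith [sq_nonneg ((x : ℤ) - y'), sq_nonneg ((x' : ℤ) - y),
      mul_pos hx1 hx4, mul_pos hx2 hx3, mul_pos hx1 hx1, mul_pos hx2 hx2, mul_pos hx3 hx3,
      mul_pos hx4 hx4]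
  have heq : x * y' = x' * y := by zify; linarith
  have hxx : x = x' := Nat.dvd_antisymm
    (hc.dvd_of_dvd_mul_right (Dvd.intro _ heq)) (hc'.dvd_of_dvd_mul_right (Dvd.intro _ heq.symm))
  subst hxx
  exact ⟨rfl, (Nat.eq_of_mul_eq_mul_left hx heq).symm⟩

/-- The representations of `n` as a sum of two positive squares, as ordered pairs. -/
def sumTwoSquaresReps (n : ℕ) : Finset (ℕ × ℕ) :=
  (Icc 1 n ×ˢ Icc 1 n).filter fun v => v.1 ^ 2 + v.2 ^ 2 = n

lemma mem_sumTwoSquaresReps {n : ℕ} {v : ℕ × ℕ} :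
    v ∈ sumTwoSquaresReps n ↔ 0 < v.1 ∧ 0 < v.2 ∧ v.1 ^ 2 + v.2 ^ 2 = n := by
  simp only [sumTwoSquaresReps, mem_filter, mem_product, mem_Icc]
  constructor
  · rintro ⟨⟨⟨h1, -⟩, h2, -⟩, h3⟩
    exact ⟨h1, h2, h3⟩
  · rintro ⟨h1, h2, h3⟩
    exact ⟨⟨⟨h1, by nlinarith⟩, h2, by nlinarith⟩, h3⟩

/-- A representation is determined by `gcd(x, y)` together with the divisor of `n` from
`eq_of_gcd_cross_eq`. -/
theorem card_sumTwoSquaresReps_le (n : ℕ) :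
    (sumTwoSquaresReps n).card ≤ n.divisors.card * n.divisors.card := by
  refine card_le_mul_card_image_of_maps_to (f := fun v : ℕ × ℕ => Nat.gcd v.1 v.2)
    (fun v hv => ?_) _ fun c _ => ?_
  · obtain ⟨h1, h2, h3⟩ := mem_sumTwoSquaresReps.1 hv
    rw [Nat.mem_divisors]
    refine ⟨?_, by rw [← h3]; positivity⟩
    rw [← h3]
    exact ((Nat.gcd_dvd_left _ _).trans (dvd_pow_self _ two_ne_zero)).add
      ((Nat.gcd_dvd_right _ _).trans (dvd_pow_self _ two_ne_zero))
  · rcases ((sumTwoSquaresReps n).filter fun v => Nat.gcd v.1 v.2 = c).eq_empty_or_nonempty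
      with h0 | ⟨w, hw⟩
    · rw [h0]; simp
    -- dividing by the common gcd `c` reduces to coprime representations of `n / c ^ 2`
    have red : ∀ v ∈ (sumTwoSquaresReps n).filter fun v => Nat.gcd v.1 v.2 = c,
        0 < v.1 / c ∧ 0 < v.2 / c ∧ (v.1 / c) ^ 2 + (v.2 / c) ^ 2 = n / c ^ 2 ∧
        (v.1 / c).Coprime (v.2 / c) ∧ v.1 = c * (v.1 / c) ∧ v.2 = c * (v.2 / c) ∧
        c ^ 2 ∣ n ∧ 0 < n := by
      rintro ⟨a, b⟩ hv
      obtain ⟨hv, hc⟩ := mem_filter.1 hv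
      obtain ⟨h1, h2, h3⟩ := mem_sumTwoSquaresReps.1 hv
      simp only at h1 h2 h3 hc ⊢
      have hcpos : 0 < c := hc ▸ Nat.gcd_pos_of_pos_left _ h1
      obtain ⟨a', rfl⟩ : c ∣ a := hc ▸ Nat.gcd_dvd_left _ _
      obtain ⟨b', rfl⟩ : c ∣ b := hc ▸ Nat.gcd_dvd_right _ _
      have hn : n = c ^ 2 * (a' ^ 2 + b' ^ 2) := by rw [← h3]; ring
      rw [Nat.mul_div_cancel_left _ hcpos, Nat.mul_div_cancel_left _ hcpos]
      refine ⟨Nat.pos_of_mul_pos_left h1, Nat.pos_of_mul_pos_left h2, ?_, ?_, rfl, rfl,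
        Dvd.intro _ hn.symm, by rw [← h3]; positivity⟩
      · rw [hn, Nat.mul_div_cancel_left _ (by positivity)]
      · rw [Nat.gcd_mul_left] at hc
        exact Nat.eq_of_mul_eq_mul_left hcpos (by rw [hc, mul_one])
    obtain ⟨-, -, hw3, hw4, -, -, hcn, hn⟩ := red w hw
    refine card_le_card_of_injOn
      (fun v => Int.gcd ((n / c ^ 2 : ℕ) : ℤ)
        ((v.1 / c : ℕ) * (w.2 / c : ℕ) - (w.1 / c : ℕ) * (v.2 / c : ℕ))) ?_ ?_
    · intro v _
      simp only [SetLike.mem_coe, Nat.mem_divisors]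
      refine ⟨?_, hn.ne'⟩
      refine (Int.natCast_dvd_natCast.1 (Int.gcd_dvd_left ..)).trans (Nat.div_dvd_of_dvd hcn)
    · intro u hu v hv huv
      obtain ⟨u1, u2, u3, u4, u5, u6, -⟩ := red u hu
      obtain ⟨v1, v2, v3, v4, v5, v6, -⟩ := red v hv
      obtain ⟨e1, e2⟩ := eq_of_gcd_cross_eq u1 u2 v1 v2 u3 v3 hw3 u4 v4 hw4 huv
      ext
      · rw [u5, v5, e1]
      · rw [u6, v6, e2]

theorem exists_card_sumTwoSquaresReps_le_rpow {ε : ℝ} (hε : 0 < ε) :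
    ∃ C : ℝ, 1 ≤ C ∧ ∀ n : ℕ, n ≠ 0 → ((sumTwoSquaresReps n).card : ℝ) ≤ C * (n : ℝ) ^ ε := by
  obtain ⟨C, hC, h⟩ := exists_card_divisors_le_rpow (half_pos hε)
  refine ⟨C * C, one_le_mul_of_one_le_of_one_le hC hC, fun n hn => ?_⟩
  calc ((sumTwoSquaresReps n).card : ℝ) ≤ n.divisors.card * n.divisors.card := by
        exact_mod_cast card_sumTwoSquaresReps_le n
    _ ≤ (C * (n : ℝ) ^ (ε / 2)) * (C * (n : ℝ) ^ (ε / 2)) := by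
        gcongr <;> exact h n hn
    _ = C * C * ((n : ℝ) ^ (ε / 2) * (n : ℝ) ^ (ε / 2)) := by ring
    _ = _ := by
        rw [← Real.rpow_add (by positivity), add_halves]

/-! ### The truncated Möbius sum -/

lemma dvd_of_sq_dvd_sq_mul_squarefree {a b d : ℕ} (hb : 0 < b) (ha : Squarefree a)
    (h : d ^ 2 ∣ b ^ 2 * a) : d ∣ b := by
  obtain ⟨g, d', b', hg, hcop, rfl, rfl⟩ := Nat.exists_coprime' (Nat.gcd_pos_of_pos_right d hb)
  rw [mul_pow, mul_pow, mul_right_comm] at h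
  have h1 : d' ^ 2 ∣ b' ^ 2 * a := Nat.dvd_of_mul_dvd_mul_right (by positivity) h
  have h2 : d' ^ 2 ∣ a := (hcop.pow 2 2).dvd_of_dvd_mul_left h1
  have h3 : d' = 1 := Nat.isUnit_iff.1 (ha d' (by rwa [← sq]))
  rw [h3, one_mul]
  exact Dvd.intro_left _ rfl

/-- The indicator of square-free numbers is `∑ μ(d)` over `d ^ 2 ∣ N`. -/
theorem sum_moebius_sq_dvd {N : ℕ} (hN : N ≠ 0) :
    ∑ d ∈ N.divisors with d ^ 2 ∣ N, ArithmeticFunction.moebius d =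
      if Squarefree N then 1 else 0 := by
  obtain ⟨a, b, rfl, ha⟩ := Nat.sq_mul_squarefree N
  have hb : 0 < b := Nat.pos_of_ne_zero fun h => hN (by simp [h])
  have hset : ((b ^ 2 * a).divisors.filter fun d => d ^ 2 ∣ b ^ 2 * a) = b.divisors := by
    ext d
    simp only [mem_filter, Nat.mem_divisors]
    constructor
    · rintro ⟨-, h⟩
      exact ⟨dvd_of_sq_dvd_sq_mul_squarefree hb ha h, hb.ne'⟩
    · rintro ⟨h, -⟩
      have h2 : d ^ 2 ∣ b ^ 2 * a := (pow_dvd_pow_of_dvd h 2).mul_right _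
      exact ⟨⟨(dvd_pow_self d two_ne_zero).trans h2, hN⟩, h2⟩
  rw [hset, ← ArithmeticFunction.coe_mul_zeta_apply, ArithmeticFunction.moebius_mul_coe_zeta,
    ArithmeticFunction.one_apply]
  refine if_congr ⟨?_, fun h => ?_⟩ rfl rfl
  · rintro rfl
    simpa using ha
  · exact Nat.isUnit_iff.1 (h b ⟨a, by ring⟩)

theorem abs_indicator_squarefree_sub_sum_moebius_le {N : ℕ} (hN : N ≠ 0) (z : ℕ) :
    |(if Squarefree N then (1 : ℝ) else 0) -
        ∑ d ∈ Icc 1 z with d ^ 2 ∣ N, (ArithmeticFunction.moebius d : ℝ)| ≤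
      (N.divisors.filter fun d => z < d ∧ d ^ 2 ∣ N).card := by
  have h1 : (if Squarefree N then (1 : ℝ) else 0) =
      ∑ d ∈ N.divisors with d ^ 2 ∣ N, (ArithmeticFunction.moebius d : ℝ) := by
    have := sum_moebius_sq_dvd hN
    exact_mod_cast this.symm
  have hdiv : ∀ {d}, d ^ 2 ∣ N → d ∣ N := fun h => (dvd_pow_self _ two_ne_zero).trans h
  have hset : ((N.divisors.filter fun d => d ^ 2 ∣ N).filter fun d => ¬ z < d) =
      (Icc 1 z).filter fun d => d ^ 2 ∣ N := by
    ext d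
    simp only [mem_filter, Nat.mem_divisors, mem_Icc, not_lt]
    constructor
    · rintro ⟨⟨⟨h, -⟩, h2⟩, h3⟩
      exact ⟨⟨Nat.pos_of_dvd_of_pos h (Nat.pos_of_ne_zero hN), h3⟩, h2⟩
    · rintro ⟨⟨-, h3⟩, h2⟩
      exact ⟨⟨⟨hdiv h2, hN⟩, h2⟩, h3⟩
  rw [h1, ← sum_filter_add_sum_filter_not (N.divisors.filter fun d => d ^ 2 ∣ N) (fun d => z < d),
    hset, add_sub_cancel_right, filter_filter]
  refine (abs_sum_le_sum_abs _ _).trans ?_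
  calc _ ≤ ∑ d ∈ N.divisors with d ^ 2 ∣ N ∧ z < d, (1 : ℝ) := by
        refine sum_le_sum fun d _ => ?_
        exact_mod_cast ArithmeticFunction.abs_moebius_le_one
    _ = _ := by simp [and_comm]

/-! ### Products with a large square divisor -/

lemma exists_mul_eq_of_sq_dvd_mul {d m k : ℕ} (hmk : m.Coprime k) (h : d ^ 2 ∣ m * k) :
    ∃ a b, a * b = d ∧ a ^ 2 ∣ m ∧ b ^ 2 ∣ k := by
  have hd : d ∣ m * k := (dvd_pow_self d two_ne_zero).trans h
  refine ⟨d.gcd m, d.gcd k, ?_, ?_, ?_⟩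
  · rw [← Nat.Coprime.gcd_mul d hmk, Nat.gcd_eq_left hd]
  · refine Nat.Coprime.dvd_of_dvd_mul_right ?_ ((pow_dvd_pow_of_dvd (Nat.gcd_dvd_left d m) 2).trans h)
    exact (hmk.coprime_dvd_left (Nat.gcd_dvd_right _ _)).pow_left 2
  · refine Nat.Coprime.dvd_of_dvd_mul_left ?_ ((pow_dvd_pow_of_dvd (Nat.gcd_dvd_left d k) 2).trans h)
    exact (hmk.symm.coprime_dvd_left (Nat.gcd_dvd_right _ _)).pow_left 2

lemma coprime_succ_succ (n : ℕ) : (n + 1).Coprime (n + 2) :=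
  (Nat.coprime_self_add_right (m := n + 1) (n := 1)).2 (Nat.coprime_one_right _)

lemma card_le_of_pairwise_modEq {A : Finset ℕ} {N q : ℕ} (hA : ∀ n ∈ A, n ≤ N)
    (h : ∀ n ∈ A, ∀ m ∈ A, n ≡ m [MOD q]) : A.card ≤ N / q + 1 := by
  rw [← card_range (N / q + 1)]
  refine card_le_card_of_injOn (fun n => n / q) (fun n hn => ?_) fun n hn m hm hnm => ?_
  · simpa [Nat.lt_succ_iff] using Nat.div_le_div_right (hA n hn)
  · have h1 := Nat.div_add_mod n q
    have h2 := Nat.div_add_mod m q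
    have h3 : n % q = m % q := h n hn m hm
    simp only at hnm
    rw [← h1, ← h2, hnm, h3]

/-- By the Chinese remainder theorem the two divisibility conditions confine `n` to one residue
class modulo `(a * b) ^ 2`; there is no solution at all unless `a` and `b` are coprime. -/
lemma card_sq_dvd_succ_and_sq_dvd_le (N a b : ℕ) :
    ((range (N + 1)).filter fun n => a ^ 2 ∣ n + 1 ∧ b ^ 2 ∣ n + 2).card ≤
      N / (a * b) ^ 2 + 1 := by
  refine card_le_of_pairwise_modEq (fun n hn => ?_) fun n hn m hm => ?_
  · simpa [Nat.lt_succ_iff] using (mem_filter.1 hn).1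
  · obtain ⟨-, h1, h2⟩ := mem_filter.1 hn
    obtain ⟨-, h3, h4⟩ := mem_filter.1 hm
    have hcop : (a ^ 2).Coprime (b ^ 2) :=
      ((coprime_succ_succ n).coprime_dvd_left h1).coprime_dvd_right h2
    rw [mul_pow, ← Nat.modEq_and_modEq_iff_modEq_mul hcop]
    constructor
    · refine Nat.ModEq.add_right_cancel' 1 ?_
      exact (Nat.modEq_zero_iff_dvd.2 h1).trans (Nat.modEq_zero_iff_dvd.2 h3).symm
    · refine Nat.ModEq.add_right_cancel' 2 ?_
      exact (Nat.modEq_zero_iff_dvd.2 h2).trans (Nat.modEq_zero_iff_dvd.2 h4).symm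

/-- The `n ≤ N` for which `(n + 1) * (n + 2)` has a square divisor `d ^ 2` with `d > z`. -/
def largeSquareDivisorSet (N z : ℕ) : Finset ℕ :=
  (range (N + 1)).filter fun n => ∃ d ∈ ((n + 1) * (n + 2)).divisors, z < d ∧ d ^ 2 ∣ (n + 1) * (n + 2)

/-- If `d = a * b` is too large, that is `a * b > 2 * X`, then one of `a`, `b` alone exceeds
`z = √X`, and it can be used with the other one replaced by `1`. -/
lemma exists_pair_of_mem_largeSquareDivisorSet {X n : ℕ} (hX : 1 ≤ X)
    (hn : n ∈ largeSquareDivisorSet (2 * X ^ 2) X.sqrt) :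
    ∃ a b, 1 ≤ a ∧ 1 ≤ b ∧ X.sqrt < a * b ∧ a * b ≤ 2 * X ∧ a ^ 2 ∣ n + 1 ∧ b ^ 2 ∣ n + 2 := by
  obtain ⟨hn1, d, -, hd, hdvd⟩ := mem_filter.1 hn
  rw [mem_range] at hn1
  obtain ⟨a, b, rfl, ha, hb⟩ := exists_mul_eq_of_sq_dvd_mul (coprime_succ_succ n) hdvd
  have ha0 : 0 < a := Nat.pos_of_mul_pos_right (lt_of_le_of_lt (Nat.zero_le _) hd)
  have hb0 : 0 < b := Nat.pos_of_mul_pos_left (lt_of_le_of_lt (Nat.zero_le _) hd)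
  have ha2 : a ≤ 2 * X := by
    have := Nat.le_of_dvd (by positivity) ha
    nlinarith
  have hb2 : b ≤ 2 * X := by
    have := Nat.le_of_dvd (by positivity) hb
    nlinarith
  by_cases hab : a * b ≤ 2 * X
  · exact ⟨a, b, ha0, hb0, hd, hab, ha, hb⟩
  by_cases haz : X.sqrt < a
  · exact ⟨a, 1, ha0, le_rfl, by simpa using haz, by simpa using ha2, ha, by simp⟩
  by_cases hbz : X.sqrt < b
  · exact ⟨1, b, le_rfl, hb0, by simpa using hbz, by simpa using hb2, by simp, hb⟩
  · exfalso
    have h1 : a * b ≤ X.sqrt * X.sqrt := Nat.mul_le_mul (not_lt.1 haz) (not_lt.1 hbz)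
    have h2 := Nat.sqrt_le X
    omega

/-- Each pair `(a, b)` contributes at most `2 X² / (a b)² + 1`, which is `≪ X √X / (a b)` in the
range `√X < a b ≤ 2 X`. -/
theorem card_largeSquareDivisorSet_le {X : ℕ} (hX : 1 ≤ X) :
    ((largeSquareDivisorSet (2 * X ^ 2) X.sqrt).card : ℝ) ≤
      4 * (X * √X) * (∑ a ∈ Icc 1 (2 * X), (1 / a : ℝ)) ^ 2 := by
  set P := ((Icc 1 (2 * X)) ×ˢ (Icc 1 (2 * X))).filter
    fun v : ℕ × ℕ => X.sqrt < v.1 * v.2 ∧ v.1 * v.2 ≤ 2 * X with hP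
  have hsub : largeSquareDivisorSet (2 * X ^ 2) X.sqrt ⊆ P.biUnion fun v =>
      (range (2 * X ^ 2 + 1)).filter fun n => v.1 ^ 2 ∣ n + 1 ∧ v.2 ^ 2 ∣ n + 2 := by
    intro n hn
    obtain ⟨a, b, ha, hb, h1, h2, h3, h4⟩ := exists_pair_of_mem_largeSquareDivisorSet hX hn
    refine mem_biUnion.2 ⟨(a, b), ?_, mem_filter.2 ⟨(mem_filter.1 hn).1, h3, h4⟩⟩
    simp only [hP, mem_filter, mem_product, mem_Icc]
    exact ⟨⟨⟨ha, by nlinarith⟩, hb, by nlinarith⟩, h1, h2⟩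
  have hXr : (1 : ℝ) ≤ X := by exact_mod_cast hX
  have hsq : √(X : ℝ) * √X = X := Real.mul_self_sqrt (by positivity)
  have hsX : √(X : ℝ) ≤ X := by
    have : 1 ≤ √(X : ℝ) := Real.one_le_sqrt.2 hXr
    nlinarith
  have hs1 : 1 ≤ √(X : ℝ) := Real.one_le_sqrt.2 hXr
  calc ((largeSquareDivisorSet (2 * X ^ 2) X.sqrt).card : ℝ)
      ≤ ∑ v ∈ P, (((range (2 * X ^ 2 + 1)).filter fun n =>
          v.1 ^ 2 ∣ n + 1 ∧ v.2 ^ 2 ∣ n + 2).card : ℝ) := by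
        exact_mod_cast (card_le_card hsub).trans card_biUnion_le
    _ ≤ ∑ v ∈ P, 4 * (X * √X) * ((1 / v.1 : ℝ) * (1 / v.2 : ℝ)) := by
        refine sum_le_sum fun v hv => ?_
        simp only [hP, mem_filter, mem_product, mem_Icc] at hv
        obtain ⟨⟨⟨h1, -⟩, h2, -⟩, h3, h4⟩ := hv
        have hc : (((range (2 * X ^ 2 + 1)).filter fun n =>
            v.1 ^ 2 ∣ n + 1 ∧ v.2 ^ 2 ∣ n + 2).card : ℝ) ≤
            ((2 * X ^ 2 : ℕ) : ℝ) / ((v.1 * v.2) ^ 2 : ℕ) + 1 := by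
          calc _ ≤ (((2 * X ^ 2) / (v.1 * v.2) ^ 2 + 1 : ℕ) : ℝ) := by
                exact_mod_cast card_sq_dvd_succ_and_sq_dvd_le _ _ _
            _ ≤ _ := by
                rw [Nat.cast_add, Nat.cast_one]
                gcongr
                exact Nat.cast_div_le
        refine hc.trans ?_
        rw [one_div_mul_one_div]
        push_cast
        have ht0 : (0 : ℝ) < v.1 * v.2 := by exact_mod_cast Nat.mul_pos h1 h2
        have ht1 : √(X : ℝ) ≤ v.1 * v.2 := by
          rw [Real.sqrt_le_left ht0.le]
          exact_mod_cast (Nat.sqrt_lt'.1 h3).le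
        have ht2 : (v.1 * v.2 : ℝ) ≤ 2 * X := by exact_mod_cast h4
        set t : ℝ := v.1 * v.2
        rw [mul_one_div, ← sub_nonneg]
        have : 4 * (X * √X) / t - (2 * (X : ℝ) ^ 2 / t ^ 2 + 1) =
            (4 * (X * √X) * t - 2 * X ^ 2 - t ^ 2) / t ^ 2 := by
          field_simp
          ring
        rw [this]
        apply div_nonneg _ (by positivity)
        have e1 : (X : ℝ) ^ 2 ≤ X * √X * t := by
          have : (X : ℝ) ^ 2 = X * √X * √X := by rw [mul_assoc, hsq, sq]
          rw [this]; gcongr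
        have e2 : t ^ 2 ≤ 2 * (X * √X) * t := by
          have : t ≤ 2 * (X * √X) := by nlinarith
          nlinarith
        linarith
    _ ≤ ∑ v ∈ (Icc 1 (2 * X)) ×ˢ (Icc 1 (2 * X)),
          4 * (X * √X) * ((1 / v.1 : ℝ) * (1 / v.2 : ℝ)) := by
        refine sum_le_sum_of_subset_of_nonneg (filter_subset _ _) fun _ _ _ => by positivity
    _ = _ := by
        rw [← mul_sum, sum_product, sq, sum_mul_sum]

lemma exists_sum_one_div_le_rpow {ε : ℝ} (hε : 0 < ε) :
    ∃ C : ℝ, 1 ≤ C ∧ ∀ n : ℕ, ∑ a ∈ Icc 1 n, (1 / a : ℝ) ≤ C * (n : ℝ) ^ ε := by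
  have hs : Summable fun a : ℕ => 1 / (a : ℝ) ^ (1 + ε) :=
    Real.summable_one_div_nat_rpow.2 (by linarith)
  refine ⟨max 1 (∑' a : ℕ, 1 / (a : ℝ) ^ (1 + ε)), le_max_left _ _, fun n => ?_⟩
  calc ∑ a ∈ Icc 1 n, (1 / a : ℝ) ≤ ∑ a ∈ Icc 1 n, 1 / (a : ℝ) ^ (1 + ε) * (n : ℝ) ^ ε := by
        refine sum_le_sum fun a ha => ?_
        obtain ⟨h1, h2⟩ := mem_Icc.1 ha
        have ha0 : (0 : ℝ) < a := by exact_mod_cast h1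
        rw [Real.rpow_add ha0, Real.rpow_one, one_div_mul_eq_div, div_le_div_iff₀ ha0 (by positivity),
          one_mul, mul_comm]
        gcongr
    _ = (∑ a ∈ Icc 1 n, 1 / (a : ℝ) ^ (1 + ε)) * (n : ℝ) ^ ε := by rw [sum_mul]
    _ ≤ _ := by
        gcongr
        exact (hs.sum_le_tsum _ fun _ _ => by positivity).trans (le_max_right _ _)

/-! ### Points with a large square divisor -/

/-- The product `(x ^ 2 + y ^ 2 + 1) * (x ^ 2 + y ^ 2 + 2)`. Its two factors are coprime, so it is
square-free exactly when both of them are. -/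
def quadProd (v : ℕ × ℕ) : ℕ := (v.1 ^ 2 + v.2 ^ 2 + 1) * (v.1 ^ 2 + v.2 ^ 2 + 2)

/-- The square of side `X` in the positive quadrant. -/
def posBox (X : ℕ) : Finset (ℕ × ℕ) := Icc 1 X ×ˢ Icc 1 X

lemma mem_posBox {X : ℕ} {v : ℕ × ℕ} : v ∈ posBox X ↔ (1 ≤ v.1 ∧ v.1 ≤ X) ∧ 1 ≤ v.2 ∧ v.2 ≤ X := by
  simp [posBox]

lemma quadProd_ne_zero (v : ℕ × ℕ) : quadProd v ≠ 0 := by unfold quadProd; positivity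

lemma squarefree_quadProd_iff (v : ℕ × ℕ) : Squarefree (quadProd v) ↔
    Squarefree (v.1 ^ 2 + v.2 ^ 2 + 1) ∧ Squarefree (v.1 ^ 2 + v.2 ^ 2 + 2) :=
  Nat.squarefree_mul (coprime_succ_succ _)

lemma card_le_of_sumTwoSquaresReps_le {C ε : ℝ} (hC : 0 ≤ C) (hε : 0 ≤ ε)
    (h : ∀ n : ℕ, n ≠ 0 → ((sumTwoSquaresReps n).card : ℝ) ≤ C * (n : ℝ) ^ ε)
    {A : Finset ℕ} {N : ℕ} (hA : ∀ n ∈ A, n ≤ N) {S : Finset (ℕ × ℕ)}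
    (hS : ∀ v ∈ S, 0 < v.1 ∧ 0 < v.2 ∧ v.1 ^ 2 + v.2 ^ 2 ∈ A) :
    (S.card : ℝ) ≤ C * (N : ℝ) ^ ε * A.card := by
  rw [card_eq_sum_card_fiberwise (f := fun v : ℕ × ℕ => v.1 ^ 2 + v.2 ^ 2) (t := A)
    fun v hv => (hS v hv).2.2]
  push_cast
  calc _ ≤ ∑ n ∈ A, C * (N : ℝ) ^ ε := by
        refine sum_le_sum fun n hn => ?_
        have hsub : (S.filter fun v => v.1 ^ 2 + v.2 ^ 2 = n) ⊆ sumTwoSquaresReps n := by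
          intro v hv
          obtain ⟨hvS, rfl⟩ := mem_filter.1 hv
          exact mem_sumTwoSquaresReps.2 ⟨(hS v hvS).1, (hS v hvS).2.1, rfl⟩
        rcases eq_or_ne n 0 with rfl | hn0
        · have : sumTwoSquaresReps 0 = ∅ := rfl
          rw [this, subset_empty] at hsub
          rw [hsub]
          simp only [card_empty, Nat.cast_zero]
          positivity
        · calc _ ≤ ((sumTwoSquaresReps n).card : ℝ) := by exact_mod_cast card_le_card hsub
            _ ≤ C * (n : ℝ) ^ ε := h n hn0
            _ ≤ _ := by
              gcongr
              exact hA n hn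
    _ = _ := by rw [sum_const, nsmul_eq_mul, mul_comm]

/-- The total error made in the box when the Möbius sum is truncated at `√X`. -/
theorem exists_sum_card_large_divisors_le {ε : ℝ} (hε : 0 < ε) :
    ∃ C : ℝ, 0 ≤ C ∧ ∀ X : ℕ, 1 ≤ X →
      ∑ v ∈ posBox X, (((quadProd v).divisors.filter
        fun d => X.sqrt < d ∧ d ^ 2 ∣ quadProd v).card : ℝ) ≤ C * (X : ℝ) ^ ε * (X * √X) := by
  set δ := ε / 8 with hδ
  have hδ0 : 0 < δ := by positivity
  obtain ⟨C₁, hC₁, h₁⟩ := exists_card_divisors_le_rpow hδ0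
  obtain ⟨C₂, hC₂, h₂⟩ := exists_card_sumTwoSquaresReps_le_rpow hδ0
  obtain ⟨C₃, hC₃, h₃⟩ := exists_sum_one_div_le_rpow hδ0
  refine ⟨C₁ * 12 ^ δ * (C₂ * 2 ^ δ) * (4 * (C₃ * 2 ^ δ) ^ 2), by positivity, fun X hX => ?_⟩
  have hX0 : (0 : ℝ) < X := by exact_mod_cast hX
  set S := (posBox X).filter fun v => v.1 ^ 2 + v.2 ^ 2 ∈ largeSquareDivisorSet (2 * X ^ 2) X.sqrt
    with hSdef
  have hle : ∀ v ∈ posBox X, v.1 ^ 2 + v.2 ^ 2 ≤ 2 * X ^ 2 := by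
    intro v hv
    obtain ⟨⟨-, h1⟩, -, h2⟩ := mem_posBox.1 hv
    nlinarith
  have hτ : ∀ v ∈ posBox X, ((quadProd v).divisors.card : ℝ) ≤ C₁ * 12 ^ δ * (X : ℝ) ^ (4 * δ) := by
    intro v hv
    have h12 : quadProd v ≤ 12 * X ^ 4 := by
      have := hle v hv
      have hX2 : 1 ≤ X ^ 2 := Nat.one_le_pow _ _ hX
      calc quadProd v ≤ (3 * X ^ 2) * (4 * X ^ 2) := by
            unfold quadProd
            apply Nat.mul_le_mul <;> omega
        _ = _ := by ring
    calc ((quadProd v).divisors.card : ℝ) ≤ C₁ * (quadProd v : ℝ) ^ δ := h₁ _ (quadProd_ne_zero v)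
      _ ≤ C₁ * (12 * (X : ℝ) ^ 4) ^ δ := by
          gcongr
          exact_mod_cast h12
      _ = _ := by
          rw [Real.mul_rpow (by norm_num) (by positivity), ← Real.rpow_natCast, ← Real.rpow_mul hX0.le,
            mul_assoc]
          norm_num
  have hS : (S.card : ℝ) ≤ C₂ * 2 ^ δ * (X : ℝ) ^ (2 * δ) *
      (4 * (X * √X) * (C₃ * 2 ^ δ * (X : ℝ) ^ δ) ^ 2) := by
    calc (S.card : ℝ) ≤ C₂ * ((2 * X ^ 2 : ℕ) : ℝ) ^ δ *
          (largeSquareDivisorSet (2 * X ^ 2) X.sqrt).card := by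
          refine card_le_of_sumTwoSquaresReps_le (by positivity) hδ0.le h₂ (fun n hn => ?_)
            fun v hv => ?_
          · have := (mem_filter.1 hn).1
            rw [mem_range] at this
            omega
          · obtain ⟨hv1, hv2⟩ := mem_filter.1 hv
            obtain ⟨⟨h1, -⟩, h2, -⟩ := mem_posBox.1 hv1
            exact ⟨h1, h2, hv2⟩
      _ ≤ C₂ * ((2 * X ^ 2 : ℕ) : ℝ) ^ δ *
          (4 * (X * √X) * (C₃ * ((2 * X : ℕ) : ℝ) ^ δ) ^ 2) := by
          gcongr
          refine (card_largeSquareDivisorSet_le hX).trans ?_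
          gcongr
          exact h₃ _
      _ = _ := by
          push_cast
          rw [Real.mul_rpow (by norm_num) (by positivity), Real.mul_rpow (by norm_num) hX0.le,
            ← Real.rpow_natCast (X : ℝ) 2, ← Real.rpow_mul hX0.le]
          push_cast
          ring
  calc _ = ∑ v ∈ S, (((quadProd v).divisors.filter
        fun d => X.sqrt < d ∧ d ^ 2 ∣ quadProd v).card : ℝ) := by
        symm
        refine sum_subset (filter_subset _ _) fun v hv hvS => ?_
        rw [Nat.cast_eq_zero, card_eq_zero, filter_eq_empty_iff]
        rintro d hd ⟨hd1, hd2⟩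
        refine hvS (mem_filter.2 ⟨hv, mem_filter.2 ⟨?_, d, hd, hd1, hd2⟩⟩)
        rw [mem_range]
        have := hle v hv
        omega
    _ ≤ ∑ v ∈ S, C₁ * 12 ^ δ * (X : ℝ) ^ (4 * δ) := by
        refine sum_le_sum fun v hv => le_trans ?_ (hτ v (mem_filter.1 hv).1)
        exact_mod_cast card_le_card (filter_subset _ _)
    _ = S.card * (C₁ * 12 ^ δ * (X : ℝ) ^ (4 * δ)) := by rw [sum_const, nsmul_eq_mul]
    _ ≤ C₂ * 2 ^ δ * (X : ℝ) ^ (2 * δ) * (4 * (X * √X) * (C₃ * 2 ^ δ * (X : ℝ) ^ δ) ^ 2) *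
        (C₁ * 12 ^ δ * (X : ℝ) ^ (4 * δ)) := by gcongr
    _ = C₁ * 12 ^ δ * (C₂ * 2 ^ δ) * (4 * (C₃ * 2 ^ δ) ^ 2) *
        ((X : ℝ) ^ (2 * δ) * ((X : ℝ) ^ δ * (X : ℝ) ^ δ) * (X : ℝ) ^ (4 * δ)) * (X * √X) := by ring
    _ = _ := by
        rw [← Real.rpow_add hX0, ← Real.rpow_add hX0, ← Real.rpow_add hX0,
          show 2 * δ + (δ + δ) + 4 * δ = ε by rw [hδ]; ring]

/-! ### Zeros modulo `q` and points of the box -/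

/-- The number of solutions of `(x ^ 2 + y ^ 2 + 1) * (x ^ 2 + y ^ 2 + 2) = 0` modulo `q`. -/
noncomputable def rootCount (q : ℕ) : ℕ :=
  Nat.card {u : ZMod q × ZMod q // (u.1 ^ 2 + u.2 ^ 2 + 1) * (u.1 ^ 2 + u.2 ^ 2 + 2) = 0}

lemma rootCount_one : rootCount 1 = 1 := by
  rw [rootCount, Nat.card_eq_one_iff_unique]
  exact ⟨inferInstance, ⟨⟨0, Subsingleton.elim _ _⟩⟩⟩

lemma rootCount_mul {m n : ℕ} (h : m.Coprime n) :
    rootCount (m * n) = rootCount m * rootCount n := by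
  rw [rootCount, rootCount, rootCount, ← Nat.card_prod]
  let e := ZMod.chineseRemainder h
  have h1 : ∀ a, (e a).1 = 0 ∧ (e a).2 = 0 ↔ a = 0 := fun a => by
    rw [← Prod.mk_eq_zero, Prod.mk.eta, EmbeddingLike.map_eq_zero_iff]
  refine Nat.card_congr ((Equiv.subtypeEquiv
    ((e.toEquiv.prodCongr e.toEquiv).trans (Equiv.prodProdProdComm _ _ _ _)) fun u => ?_).trans
    (Equiv.subtypeProdEquivProd
      (p := fun u : ZMod m × ZMod m => (u.1 ^ 2 + u.2 ^ 2 + 1) * (u.1 ^ 2 + u.2 ^ 2 + 2) = 0)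
      (q := fun u : ZMod n × ZMod n => (u.1 ^ 2 + u.2 ^ 2 + 1) * (u.1 ^ 2 + u.2 ^ 2 + 2) = 0)))
  rw [← h1]
  have h2 : e 2 = 2 := map_ofNat e 2
  simp [h2]

/-- The number of points of the box of side `X` at which `q` divides the product. -/
def boxCount (X q : ℕ) : ℕ := ((posBox X).filter fun v => q ∣ quadProd v).card

lemma card_filter_natCast_eq (X : ℕ) {q : ℕ} [NeZero q] (u : ZMod q) :
    ((((Icc 1 X).filter fun x : ℕ => (x : ZMod q) = u).card : ℤ) : ℚ) =
      max (⌊((X : ℚ) - u.val) / q⌋ - ⌊((0 : ℚ) - u.val) / q⌋ : ℤ) 0 := by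
  have := Nat.Ioc_filter_modEq_card 0 X (Nat.pos_of_ne_zero (NeZero.ne q)) u.val
  rw [Nat.cast_zero] at this
  rw [← this]
  congr 3
  ext x
  simp only [mem_filter, mem_Icc, mem_Ioc, Nat.succ_le_iff]
  rw [← ZMod.natCast_eq_natCast_iff, ZMod.natCast_zmod_val]

lemma abs_card_filter_natCast_sub_le (X : ℕ) {q : ℕ} [NeZero q] (u : ZMod q) :
    |(((Icc 1 X).filter fun x : ℕ => (x : ZMod q) = u).card : ℝ) - X / q| ≤ 1 := by
  suffices |((((Icc 1 X).filter fun x : ℕ => (x : ZMod q) = u).card : ℤ) : ℚ) - X / q| ≤ 1 by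
    have h := (Rat.cast_le (K := ℝ)).2 this
    push_cast at h
    exact h
  rw [card_filter_natCast_eq]
  have h1 := Int.floor_le (((X : ℚ) - u.val) / q)
  have h2 := Int.lt_floor_add_one (((X : ℚ) - u.val) / q)
  have h3 := Int.floor_le (((0 : ℚ) - u.val) / q)
  have h4 := Int.lt_floor_add_one (((0 : ℚ) - u.val) / q)
  have hmono : ⌊((0 : ℚ) - u.val) / q⌋ ≤ ⌊((X : ℚ) - u.val) / q⌋ := by
    gcongr
    positivity
  rw [max_eq_left (by linarith)]
  push_cast
  have : (X : ℚ) / q = ((X : ℚ) - u.val) / q - ((0 : ℚ) - u.val) / q := by ring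
  rw [this, abs_le]
  constructor <;> linarith

lemma card_filter_natCast_self {q : ℕ} [NeZero q] (u : ZMod q) :
    ((Icc 1 q).filter fun x : ℕ => (x : ZMod q) = u).card = 1 := by
  have := card_filter_natCast_eq q u
  have hq : (q : ℚ) ≠ 0 := by exact_mod_cast NeZero.ne q
  rw [show ((q : ℚ) - u.val) / q = (0 - u.val) / q + 1 by field_simp; ring, Int.floor_add_one] at this
  simp at this
  exact_mod_cast this

/-- Splitting the box into residue classes. -/
lemma boxCount_eq_sum (X : ℕ) {q : ℕ} [NeZero q] :
    boxCount X q = ∑ u : ZMod q × ZMod q with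
        (u.1 ^ 2 + u.2 ^ 2 + 1) * (u.1 ^ 2 + u.2 ^ 2 + 2) = 0,
      ((Icc 1 X).filter fun x : ℕ => (x : ZMod q) = u.1).card *
        ((Icc 1 X).filter fun x : ℕ => (x : ZMod q) = u.2).card := by
  have hiff : ∀ v : ℕ × ℕ, q ∣ quadProd v ↔ (((v.1 : ZMod q)) ^ 2 + (v.2 : ZMod q) ^ 2 + 1) *
      ((v.1 : ZMod q) ^ 2 + (v.2 : ZMod q) ^ 2 + 2) = 0 := fun v => by
    rw [← ZMod.natCast_eq_zero_iff, quadProd]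
    push_cast
    rfl
  rw [boxCount, card_eq_sum_card_fiberwise
    (f := fun v : ℕ × ℕ => ((v.1 : ZMod q), (v.2 : ZMod q))) (t := univ.filter
      fun u : ZMod q × ZMod q => (u.1 ^ 2 + u.2 ^ 2 + 1) * (u.1 ^ 2 + u.2 ^ 2 + 2) = 0)]
  · refine sum_congr rfl fun u hu => ?_
    rw [← card_product]
    congr 1
    ext v
    simp only [mem_filter, mem_univ, true_and] at hu
    simp only [mem_filter, mem_posBox, mem_product, mem_Icc, Prod.ext_iff, hiff]
    constructor
    · rintro ⟨⟨⟨h1, h2⟩, -⟩, h3, h4⟩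
      exact ⟨⟨h1, h3⟩, h2, h4⟩
    · rintro ⟨⟨h1, h3⟩, h2, h4⟩
      exact ⟨⟨⟨h1, h2⟩, by rw [h3, h4]; exact hu⟩, h3, h4⟩
  · intro v hv
    simpa using (hiff v).1 (mem_filter.1 hv).2

lemma rootCount_eq_card (q : ℕ) [NeZero q] : rootCount q = (univ.filter
    fun u : ZMod q × ZMod q => (u.1 ^ 2 + u.2 ^ 2 + 1) * (u.1 ^ 2 + u.2 ^ 2 + 2) = 0).card := by
  rw [rootCount, Nat.card_eq_fintype_card, Fintype.card_subtype]

lemma boxCount_self (q : ℕ) [NeZero q] : boxCount q q = rootCount q := by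
  rw [boxCount_eq_sum, rootCount_eq_card]
  simp [card_filter_natCast_self]

theorem abs_boxCount_sub_le (X q : ℕ) [NeZero q] :
    |(boxCount X q : ℝ) - rootCount q * ((X : ℝ) / q) ^ 2| ≤ rootCount q * (2 * (X / q) + 1) := by
  rw [boxCount_eq_sum, rootCount_eq_card, card_eq_sum_ones]
  push_cast
  rw [sum_mul, sum_mul, ← sum_sub_distrib]
  refine (abs_sum_le_sum_abs _ _).trans (sum_le_sum fun u _ => ?_)
  have h1 := abs_le.1 (abs_card_filter_natCast_sub_le X u.1)
  have h2 := abs_le.1 (abs_card_filter_natCast_sub_le X u.2)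
  set a : ℝ := (((Icc 1 X).filter fun x : ℕ => (x : ZMod q) = u.1).card : ℝ)
  set b : ℝ := (((Icc 1 X).filter fun x : ℕ => (x : ZMod q) = u.2).card : ℝ)
  have ha : 0 ≤ a := Nat.cast_nonneg _
  have hb : 0 ≤ b := Nat.cast_nonneg _
  have ht : (0 : ℝ) ≤ X / q := by positivity
  set t : ℝ := X / q
  rw [one_mul, one_mul, abs_le]
  constructor <;> nlinarith

/-- The number of solutions modulo `d ^ 2` is `≪ d ^ (2 + ε)`. The values `x ^ 2 + y ^ 2` that
occur lie in `τ(d)` residue classes modulo `d ^ 2`, and each has few representations. -/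
theorem exists_rootCount_sq_le {ε : ℝ} (hε : 0 < ε) :
    ∃ C : ℝ, 0 ≤ C ∧ ∀ d : ℕ, 1 ≤ d → (rootCount (d ^ 2) : ℝ) ≤ C * (d : ℝ) ^ ε * (d : ℝ) ^ 2 := by
  set δ := ε / 5 with hδ
  have hδ0 : 0 < δ := by positivity
  obtain ⟨C₁, hC₁, h₁⟩ := exists_card_divisors_le_rpow hδ0
  obtain ⟨C₂, hC₂, h₂⟩ := exists_card_sumTwoSquaresReps_le_rpow hδ0
  refine ⟨C₂ * 2 ^ δ * C₁ * 3, by positivity, fun d hd => ?_⟩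
  have hd0 : (0 : ℝ) < d := by exact_mod_cast hd
  have : NeZero (d ^ 2) := ⟨by positivity⟩
  set A := (range (2 * d ^ 4 + 1)).filter fun n => d ^ 2 ∣ (n + 1) * (n + 2) with hA
  have hAcard : A.card ≤ d.divisors.card * (3 * d ^ 2) := by
    have hsub : A ⊆ d.divisorsAntidiagonal.biUnion fun w =>
        (range (2 * d ^ 4 + 1)).filter fun n => w.1 ^ 2 ∣ n + 1 ∧ w.2 ^ 2 ∣ n + 2 := by
      intro n hn
      obtain ⟨hn1, hn2⟩ := mem_filter.1 hn
      obtain ⟨a, b, hab, ha, hb⟩ := exists_mul_eq_of_sq_dvd_mul (coprime_succ_succ n) hn2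
      exact mem_biUnion.2 ⟨(a, b), Nat.mem_divisorsAntidiagonal.2 ⟨hab, by omega⟩,
        mem_filter.2 ⟨hn1, ha, hb⟩⟩
    calc A.card ≤ d.divisorsAntidiagonal.card * (3 * d ^ 2) := by
          refine (card_le_card hsub).trans (card_biUnion_le_card_mul _ _ _ fun w hw => ?_)
          refine (card_sq_dvd_succ_and_sq_dvd_le _ _ _).trans ?_
          rw [(Nat.mem_divisorsAntidiagonal.1 hw).1,
            show 2 * d ^ 4 = 2 * d ^ 2 * d ^ 2 by ring, Nat.mul_div_cancel _ (by positivity)]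
          have : 1 ≤ d ^ 2 := Nat.one_le_pow _ _ hd
          omega
      _ = _ := by rw [← Nat.map_div_right_divisors, card_map]
  rw [← boxCount_self, boxCount]
  calc _ ≤ C₂ * ((2 * d ^ 4 : ℕ) : ℝ) ^ δ * A.card := by
        refine card_le_of_sumTwoSquaresReps_le (by positivity) hδ0.le h₂ (fun n hn => ?_)
          fun v hv => ?_
        · have := (mem_filter.1 hn).1
          rw [mem_range] at this
          omega
        · obtain ⟨hv1, hv2⟩ := mem_filter.1 hv
          obtain ⟨⟨h1, h3⟩, h2, h4⟩ := mem_posBox.1 hv1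
          refine ⟨h1, h2, mem_filter.2 ⟨?_, hv2⟩⟩
          rw [mem_range]
          nlinarith
    _ ≤ C₂ * ((2 * d ^ 4 : ℕ) : ℝ) ^ δ * (C₁ * (d : ℝ) ^ δ * (3 * (d : ℝ) ^ 2)) := by
        gcongr
        calc (A.card : ℝ) ≤ d.divisors.card * (3 * (d : ℝ) ^ 2) := by exact_mod_cast hAcard
          _ ≤ _ := by
            gcongr
            exact h₁ d (by omega)
    _ = C₂ * 2 ^ δ * C₁ * 3 * ((d : ℝ) ^ (4 * δ) * (d : ℝ) ^ δ) * (d : ℝ) ^ 2 := by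
        push_cast
        rw [Real.mul_rpow (by norm_num) (by positivity), ← Real.rpow_natCast (d : ℝ) 4,
          ← Real.rpow_mul hd0.le]
        push_cast
        ring
    _ = _ := by
        rw [← Real.rpow_add hd0, show 4 * δ + δ = ε by rw [hδ]; ring]

/-! ### The singular series and its Euler product -/

/-- The coefficient `μ(d) ρ(d ^ 2) / d ^ 4` of the singular series, where `ρ` is `rootCount`. -/
noncomputable def seriesCoeff (d : ℕ) : ℝ :=
  (ArithmeticFunction.moebius d : ℝ) * rootCount (d ^ 2) / (d : ℝ) ^ 4

lemma abs_moebius_le_one_real (d : ℕ) : |(ArithmeticFunction.moebius d : ℝ)| ≤ 1 := by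
  exact_mod_cast ArithmeticFunction.abs_moebius_le_one

lemma exists_abs_seriesCoeff_le {ε : ℝ} (hε : 0 < ε) :
    ∃ C : ℝ, 0 ≤ C ∧ ∀ d : ℕ, |seriesCoeff d| ≤ C * (d : ℝ) ^ (ε - 2) := by
  obtain ⟨C, hC, h⟩ := exists_rootCount_sq_le hε
  refine ⟨C, hC, fun d => ?_⟩
  rcases Nat.eq_zero_or_pos d with rfl | hd
  · simp only [seriesCoeff, ArithmeticFunction.map_zero, Int.cast_zero, zero_mul, zero_div, abs_zero]
    positivity
  have hd0 : (0 : ℝ) < d := by exact_mod_cast hd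
  rw [seriesCoeff, abs_div, abs_mul, Nat.abs_cast, abs_of_nonneg (by positivity : (0 : ℝ) ≤ d ^ 4)]
  calc _ ≤ 1 * (C * (d : ℝ) ^ ε * (d : ℝ) ^ 2) / (d : ℝ) ^ 4 := by
        gcongr
        · exact abs_moebius_le_one_real d
        · exact h d hd
    _ = _ := by
        rw [Real.rpow_sub hd0, show (2 : ℝ) = ((2 : ℕ) : ℝ) by norm_num, Real.rpow_natCast]
        field_simp

lemma summable_abs_seriesCoeff : Summable fun d => |seriesCoeff d| := by
  obtain ⟨C, hC, h⟩ := exists_abs_seriesCoeff_le (ε := 1 / 2) (by norm_num)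
  exact .of_nonneg_of_le (fun _ => abs_nonneg _) h
    ((Real.summable_nat_rpow.2 (by norm_num)).mul_left C)

lemma summable_seriesCoeff : Summable seriesCoeff := summable_abs_seriesCoeff.of_abs

lemma seriesCoeff_one : seriesCoeff 1 = 1 := by
  simp [seriesCoeff, rootCount_one]

lemma seriesCoeff_mul {m n : ℕ} (h : m.Coprime n) :
    seriesCoeff (m * n) = seriesCoeff m * seriesCoeff n := by
  rw [seriesCoeff, seriesCoeff, seriesCoeff,
    ArithmeticFunction.isMultiplicative_moebius.map_mul_of_coprime h, mul_pow m n 2,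
    rootCount_mul (h.pow 2 2)]
  push_cast
  ring

lemma seriesCoeff_zero : seriesCoeff 0 = 0 := by simp [seriesCoeff]

/-- As `p ^ 2` divides a product of two consecutive numbers if and only if it divides exactly one
of them, the two counts `λ` add up to the number of zeros of the product. -/
lemma solutionCount_add_solutionCount {p : ℕ} (hp : p.Prime) :
    solutionCount (p ^ 2) 1 + solutionCount 1 (p ^ 2) = boxCount (p ^ 2) (p ^ 2) := by
  rw [solutionCount, solutionCount, boxCount, mul_one, one_mul, ← posBox, ← card_union_of_disjoint]
  · congr 1
    ext v
    have hcop := coprime_succ_succ (v.1 ^ 2 + v.2 ^ 2)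
    rw [mem_union, mem_filter, mem_filter, mem_filter, quadProd]
    simp only [Nat.modEq_zero_iff_dvd, one_dvd, and_true, true_and, ← and_or_left]
    refine and_congr_right fun _ => ⟨?_, fun h => ?_⟩
    · rintro (h | h)
      · exact h.mul_right _
      · exact h.mul_left _
    · by_cases h1 : p ∣ v.1 ^ 2 + v.2 ^ 2 + 1
      · left
        refine Nat.Coprime.dvd_of_dvd_mul_right ?_ h
        exact (hcop.coprime_dvd_left h1).pow_left 2
      · right
        refine Nat.Coprime.dvd_of_dvd_mul_left ?_ h
        exact ((Nat.Prime.coprime_iff_not_dvd hp).2 h1).pow_left 2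
  · rw [disjoint_filter]
    rintro v - ⟨h1, -⟩ ⟨-, h2⟩
    rw [Nat.modEq_zero_iff_dvd] at h1 h2
    have h3 := Nat.dvd_gcd h1 h2
    rw [coprime_succ_succ, Nat.dvd_one] at h3
    have := hp.two_le
    nlinarith

lemma sigmaFactor_eq (p : Nat.Primes) :
    sigmaFactor p = 1 - (boxCount ((p : ℕ) ^ 2) ((p : ℕ) ^ 2) : ℝ) / (p : ℝ) ^ 4 := by
  rw [sigmaFactor, ← Nat.cast_add, solutionCount_add_solutionCount p.2]

lemma tsum_seriesCoeff_prime_pow (p : Nat.Primes) :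
    ∑' e : ℕ, seriesCoeff ((p : ℕ) ^ e) = sigmaFactor p := by
  have : NeZero ((p : ℕ) ^ 2) := ⟨pow_ne_zero _ p.2.ne_zero⟩
  rw [tsum_eq_sum (s := range 2), sum_range_succ, sum_range_one, pow_zero, pow_one, seriesCoeff_one,
    sigmaFactor_eq, boxCount_self, seriesCoeff, ArithmeticFunction.moebius_apply_prime p.2]
  · push_cast
    ring
  · intro e he
    rw [mem_range, not_lt] at he
    rw [seriesCoeff, ArithmeticFunction.moebius_apply_prime_pow p.2 (by omega), if_neg (by omega)]
    simp

theorem hasProd_sigmaFactor : HasProd sigmaFactor (∑' d, seriesCoeff d) := by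
  have := EulerProduct.eulerProduct_hasProd (f := seriesCoeff) seriesCoeff_one
    (fun h => seriesCoeff_mul h) (by simpa using summable_abs_seriesCoeff) seriesCoeff_zero
  simpa only [tsum_seriesCoeff_prime_pow] using this

lemma sigmaConst_eq : sigmaConst = ∑' d, seriesCoeff d := hasProd_sigmaFactor.tprod_eq

/-- No factor vanishes: the point `(p ^ 2, p ^ 2)`, where the product is `2` modulo `p ^ 2`, is
never counted. -/
lemma sigmaFactor_pos (p : Nat.Primes) : 0 < sigmaFactor p := by
  have hp := p.2.two_le
  have hp0 : (0 : ℝ) < (p : ℕ) := by exact_mod_cast p.2.pos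
  rw [sigmaFactor_eq, sub_pos, div_lt_one (by positivity)]
  have hlt : boxCount ((p : ℕ) ^ 2) ((p : ℕ) ^ 2) < (posBox ((p : ℕ) ^ 2)).card := by
    refine card_lt_card ⟨filter_subset _ _, fun h => ?_⟩
    have hpos : 1 ≤ (p : ℕ) ^ 2 := Nat.one_le_pow _ _ p.2.pos
    have hmem : ((p : ℕ) ^ 2, (p : ℕ) ^ 2) ∈ posBox ((p : ℕ) ^ 2) :=
      mem_posBox.2 ⟨⟨hpos, le_rfl⟩, hpos, le_rfl⟩
    have h1 := (mem_filter.1 (h hmem)).2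
    have h2 : quadProd ((p : ℕ) ^ 2, (p : ℕ) ^ 2) =
        (p : ℕ) ^ 2 * (2 * (p : ℕ) ^ 2 * (2 * (p : ℕ) ^ 4 + 3)) + 2 := by
      simp only [quadProd]; ring
    rw [h2, Nat.dvd_add_right (Dvd.intro _ rfl)] at h1
    have := Nat.le_of_dvd (by norm_num) h1
    nlinarith
  have hcard : (posBox ((p : ℕ) ^ 2)).card = (p : ℕ) ^ 4 := by
    rw [posBox, card_product, Nat.card_Icc]
    simp only [Nat.add_sub_cancel]
    ring
  rw [hcard] at hlt
  exact_mod_cast hlt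

lemma summable_sigmaFactor_sub_one : Summable fun p : Nat.Primes => sigmaFactor p - 1 := by
  have h : ∀ p : Nat.Primes, seriesCoeff p = sigmaFactor p - 1 := fun p => by
    have : NeZero ((p : ℕ) ^ 2) := ⟨pow_ne_zero _ p.2.ne_zero⟩
    rw [sigmaFactor_eq, boxCount_self, seriesCoeff, ArithmeticFunction.moebius_apply_prime p.2]
    push_cast
    ring
  simpa only [← h, Function.comp_def] using
    summable_seriesCoeff.comp_injective (i := fun p : Nat.Primes => (p : ℕ)) Subtype.val_injective

theorem sigmaConst_pos : 0 < sigmaConst := by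
  have h1 : 0 ≤ sigmaConst := by
    refine ge_of_tendsto' hasProd_sigmaFactor.multipliable.hasProd fun s => ?_
    exact prod_nonneg fun p _ => (sigmaFactor_pos p).le
  have h2 : sigmaConst ≠ 0 := by
    have := tprod_one_add_ne_zero_of_summable (f := fun p : Nat.Primes => sigmaFactor p - 1)
      (fun p => by simpa using (sigmaFactor_pos p).ne')
      (by simpa using summable_sigmaFactor_sub_one.abs)
    simpa [sigmaConst] using this
  exact lt_of_le_of_ne h1 h2.symm

/-! ### The asymptotic formula -/

/-- The tail of the singular series beyond `√X`. -/
lemma exists_abs_tail_le {ε : ℝ} (hε : 0 < ε) (hε' : ε ≤ 1 / 2) :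
    ∃ C : ℝ, 0 ≤ C ∧ ∀ X : ℕ, 1 ≤ X →
      |∑ d ∈ Icc 1 X.sqrt, seriesCoeff d - sigmaConst| * (X : ℝ) ^ 2 ≤
        C * (X : ℝ) ^ ε * (X * √X) := by
  obtain ⟨C, hC, h⟩ := exists_abs_seriesCoeff_le hε
  have hs : Summable fun d : ℕ => (d : ℝ) ^ (-(1 + ε)) := Real.summable_nat_rpow.2 (by linarith)
  refine ⟨C * ∑' d : ℕ, (d : ℝ) ^ (-(1 + ε)), mul_nonneg hC (tsum_nonneg fun _ => by positivity),
    fun X hX => ?_⟩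
  have hX0 : (0 : ℝ) < X := by exact_mod_cast hX
  set s : ℝ := √X with hsdef
  have hs0 : 0 < s := Real.sqrt_pos.2 hX0
  have hss : s * s = X := Real.mul_self_sqrt hX0.le
  have hpow : s ^ (2 * ε - 1) * (X : ℝ) ^ 2 = (X : ℝ) ^ ε * (X * s) := by
    rw [Real.rpow_sub hs0, Real.rpow_mul hs0.le, Real.rpow_one, Real.rpow_two, sq s, hss]
    field_simp
    rw [← hss]; ring
  set w := X.sqrt + 1 with hw
  have hsw : s ≤ w := by
    rw [hsdef, Real.sqrt_le_left (by positivity)]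
    have := Nat.lt_succ_sqrt' X
    exact_mod_cast this.le
  have hb : ∀ i : ℕ, |seriesCoeff (i + w)| ≤
      C * s ^ (2 * ε - 1) * ((i + w : ℕ) : ℝ) ^ (-(1 + ε)) := by
    intro i
    have hi : s ≤ ((i + w : ℕ) : ℝ) := hsw.trans (by push_cast; linarith [Nat.cast_nonneg (α := ℝ) i])
    have hi0 : 0 < ((i + w : ℕ) : ℝ) := hs0.trans_le hi
    calc _ ≤ C * ((i + w : ℕ) : ℝ) ^ (ε - 2) := h _
      _ = C * (((i + w : ℕ) : ℝ) ^ (2 * ε - 1) * ((i + w : ℕ) : ℝ) ^ (-(1 + ε))) := by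
          rw [← Real.rpow_add hi0]; ring_nf
      _ ≤ C * (s ^ (2 * ε - 1) * ((i + w : ℕ) : ℝ) ^ (-(1 + ε))) := by
          gcongr C * (?_ * _)
          exact Real.rpow_le_rpow_of_nonpos hs0 hi (by linarith)
      _ = _ := by ring
  have hs' : Summable fun i : ℕ => ((i + w : ℕ) : ℝ) ^ (-(1 + ε)) := (summable_nat_add_iff w).2 hs
  have hsc : Summable fun i : ℕ => |seriesCoeff (i + w)| :=
    (summable_nat_add_iff (f := fun d => |seriesCoeff d|) w).2 summable_abs_seriesCoeff
  have hrange : ∑ d ∈ Icc 1 X.sqrt, seriesCoeff d = ∑ d ∈ range w, seriesCoeff d := by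
    refine sum_subset (fun d hd => ?_) fun d hd hd' => ?_
    · have := mem_Icc.1 hd
      rw [mem_range]; omega
    · rw [mem_range] at hd
      rw [mem_Icc] at hd'
      rw [show d = 0 by omega, seriesCoeff_zero]
  rw [hrange, sigmaConst_eq, ← summable_seriesCoeff.sum_add_tsum_nat_add w, sub_add_cancel_left,
    abs_neg]
  calc _ ≤ (∑' i, |seriesCoeff (i + w)|) * (X : ℝ) ^ 2 := by
        gcongr
        simpa only [Real.norm_eq_abs] using
          norm_tsum_le_tsum_norm (f := fun i => seriesCoeff (i + w)) (by simpa using hsc)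
    _ ≤ (∑' i : ℕ, C * s ^ (2 * ε - 1) * ((i + w : ℕ) : ℝ) ^ (-(1 + ε))) * (X : ℝ) ^ 2 := by
        gcongr ?_ * _
        exact hsc.tsum_le_tsum hb (hs'.mul_left _)
    _ ≤ (C * s ^ (2 * ε - 1) * ∑' d : ℕ, (d : ℝ) ^ (-(1 + ε))) * (X : ℝ) ^ 2 := by
        rw [tsum_mul_left]
        gcongr ?_ * _
        refine mul_le_mul_of_nonneg_left ?_ (by positivity)
        rw [← hs.sum_add_tsum_nat_add w]
        exact le_add_of_nonneg_left (sum_nonneg fun _ _ => by positivity)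
    _ = C * (∑' d : ℕ, (d : ℝ) ^ (-(1 + ε))) * (s ^ (2 * ε - 1) * (X : ℝ) ^ 2) := by ring
    _ = _ := by rw [hpow]; ring

/-- The main terms of the truncated Möbius sum. -/
lemma exists_abs_sum_moebius_mul_boxCount_sub_le {ε : ℝ} (hε : 0 < ε) :
    ∃ C : ℝ, 0 ≤ C ∧ ∀ X : ℕ, 1 ≤ X →
      |∑ d ∈ Icc 1 X.sqrt, (ArithmeticFunction.moebius d : ℝ) * boxCount X (d ^ 2) -
          (∑ d ∈ Icc 1 X.sqrt, seriesCoeff d) * (X : ℝ) ^ 2| ≤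
        C * (X : ℝ) ^ ε * (X * √X) := by
  obtain ⟨C, hC, h⟩ := exists_rootCount_sq_le hε
  refine ⟨3 * C, by positivity, fun X hX => ?_⟩
  have hX0 : (0 : ℝ) < X := by exact_mod_cast hX
  rw [sum_mul, ← sum_sub_distrib]
  calc _ ≤ ∑ d ∈ Icc 1 X.sqrt, 3 * C * (X : ℝ) ^ ε * X := by
        refine (abs_sum_le_sum_abs _ _).trans (sum_le_sum fun d hd => ?_)
        obtain ⟨hd1, hd2⟩ := mem_Icc.1 hd
        have : NeZero (d ^ 2) := ⟨by positivity⟩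
        have hd0 : (0 : ℝ) < d := by exact_mod_cast hd1
        have hdX : d ^ 2 ≤ X := Nat.le_sqrt'.1 hd2
        have hdXr : (d : ℝ) ^ 2 ≤ X := by exact_mod_cast hdX
        have hdX' : (d : ℝ) ≤ X := by
          exact_mod_cast hd2.trans (Nat.sqrt_le_self X)
        have heq : (ArithmeticFunction.moebius d : ℝ) * boxCount X (d ^ 2) -
            seriesCoeff d * (X : ℝ) ^ 2 = (ArithmeticFunction.moebius d : ℝ) *
            (boxCount X (d ^ 2) - rootCount (d ^ 2) * ((X : ℝ) / (d ^ 2 : ℕ)) ^ 2) := by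
          rw [seriesCoeff]
          push_cast
          field_simp
        rw [heq, abs_mul]
        calc _ ≤ 1 * ((C * (d : ℝ) ^ ε * (d : ℝ) ^ 2) * (2 * (X / (d ^ 2 : ℕ)) + 1)) := by
              gcongr
              · exact abs_moebius_le_one_real d
              · refine (abs_boxCount_sub_le X (d ^ 2)).trans ?_
                gcongr
                exact h d hd1
          _ = C * (d : ℝ) ^ ε * (2 * X + (d : ℝ) ^ 2) := by
              push_cast
              field_simp
          _ ≤ C * (X : ℝ) ^ ε * (2 * X + X) := by gcongr
          _ = _ := by ring
    _ = X.sqrt * (3 * C * (X : ℝ) ^ ε * X) := by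
        rw [sum_const, Nat.card_Icc, nsmul_eq_mul, Nat.add_sub_cancel]
    _ ≤ √X * (3 * C * (X : ℝ) ^ ε * X) := by
        gcongr
        exact Real.nat_sqrt_le_real_sqrt
    _ = _ := by ring

lemma squarefreePairCount_eq (H : ℝ) : (squarefreePairCount H : ℝ) =
    ∑ v ∈ posBox ⌊H⌋₊, if Squarefree (quadProd v) then (1 : ℝ) else 0 := by
  rw [sum_boole, squarefreePairCount, posBox]
  simp only [squarefree_quadProd_iff]

theorem exists_abs_squarefreePairCount_sub_le {ε : ℝ} (hε : 0 < ε) (hε' : ε ≤ 1 / 2) :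
    ∃ C : ℝ, 0 ≤ C ∧ ∀ H : ℝ, 1 ≤ H →
      |(squarefreePairCount H : ℝ) - sigmaConst * (⌊H⌋₊ : ℝ) ^ 2| ≤
        C * (⌊H⌋₊ : ℝ) ^ ε * (⌊H⌋₊ * √⌊H⌋₊) := by
  obtain ⟨C₁, hC₁, h₁⟩ := exists_sum_card_large_divisors_le hε
  obtain ⟨C₂, hC₂, h₂⟩ := exists_abs_sum_moebius_mul_boxCount_sub_le hε
  obtain ⟨C₃, hC₃, h₃⟩ := exists_abs_tail_le hε hε'
  refine ⟨C₁ + C₂ + C₃, by positivity, fun H hH => ?_⟩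
  have hX : 1 ≤ ⌊H⌋₊ := (Nat.one_le_floor_iff H).2 hH
  rw [squarefreePairCount_eq]
  set X := ⌊H⌋₊
  have hswap : ∑ v ∈ posBox X, ∑ d ∈ Icc 1 X.sqrt with d ^ 2 ∣ quadProd v,
        (ArithmeticFunction.moebius d : ℝ) =
      ∑ d ∈ Icc 1 X.sqrt, (ArithmeticFunction.moebius d : ℝ) * boxCount X (d ^ 2) := by
    simp_rw [sum_filter]
    rw [sum_comm]
    refine sum_congr rfl fun d _ => ?_
    rw [← sum_filter, sum_const, nsmul_eq_mul, mul_comm, boxCount]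
  have e₁ : |∑ v ∈ posBox X, (if Squarefree (quadProd v) then (1 : ℝ) else 0) -
      ∑ d ∈ Icc 1 X.sqrt, (ArithmeticFunction.moebius d : ℝ) * boxCount X (d ^ 2)| ≤
      C₁ * (X : ℝ) ^ ε * (X * √X) := by
    rw [← hswap, ← sum_sub_distrib]
    refine (abs_sum_le_sum_abs _ _).trans (le_trans (sum_le_sum fun v _ => ?_) (h₁ X hX))
    exact abs_indicator_squarefree_sub_sum_moebius_le (quadProd_ne_zero v) _
  have e₃ : |(∑ d ∈ Icc 1 X.sqrt, seriesCoeff d) * (X : ℝ) ^ 2 - sigmaConst * (X : ℝ) ^ 2| ≤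
      C₃ * (X : ℝ) ^ ε * (X * √X) := by
    rw [← sub_mul, abs_mul, abs_of_nonneg (by positivity : (0 : ℝ) ≤ (X : ℝ) ^ 2)]
    exact h₃ X hX
  calc _ ≤ C₁ * (X : ℝ) ^ ε * (X * √X) + C₂ * (X : ℝ) ^ ε * (X * √X) +
        C₃ * (X : ℝ) ^ ε * (X * √X) :=
        (abs_sub_le _ _ _).trans (add_le_add ((abs_sub_le _ _ _).trans (add_le_add e₁ (h₂ X hX))) e₃)
    _ = _ := by ring

/-- The argument gives the exponent `3 / 2 + ε`. -/
theorem squarefreePairCount_isBigO {ε : ℝ} (hε : 0 < ε) (hε' : ε ≤ 1 / 2) :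
    (fun H : ℝ => (squarefreePairCount H : ℝ) - sigmaConst * H ^ 2) =O[Filter.atTop]
      fun H : ℝ => H ^ ((3 : ℝ) / 2 + ε) := by
  obtain ⟨C, hC, h⟩ := exists_abs_squarefreePairCount_sub_le hε hε'
  refine Asymptotics.IsBigO.of_bound (C + 2 * sigmaConst) ?_
  filter_upwards [Filter.eventually_ge_atTop 1] with H hH
  have hH0 : 0 < H := by linarith
  have hσ := sigmaConst_pos
  rw [Real.norm_eq_abs, Real.norm_eq_abs, abs_of_nonneg (by positivity : 0 ≤ H ^ ((3 : ℝ) / 2 + ε))]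
  have hfl : (⌊H⌋₊ : ℝ) ≤ H := Nat.floor_le hH0.le
  have hfl' : H < ⌊H⌋₊ + 1 := Nat.lt_floor_add_one H
  have e₁ : |(squarefreePairCount H : ℝ) - sigmaConst * (⌊H⌋₊ : ℝ) ^ 2| ≤
      C * H ^ ((3 : ℝ) / 2 + ε) := by
    refine (h H hH).trans ?_
    calc _ ≤ C * H ^ ε * (H * √H) := by gcongr
      _ = C * H ^ ((3 : ℝ) / 2 + ε) := by
        rw [show (3 : ℝ) / 2 + ε = ε + (1 + 1 / 2) by ring, Real.rpow_add hH0, Real.rpow_add hH0,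
          Real.rpow_one, Real.sqrt_eq_rpow, mul_assoc]
  have e₂ : |sigmaConst * (⌊H⌋₊ : ℝ) ^ 2 - sigmaConst * H ^ 2| ≤
      2 * sigmaConst * H ^ ((3 : ℝ) / 2 + ε) := by
    have hH1 : H ≤ H ^ ((3 : ℝ) / 2 + ε) := by
      conv_lhs => rw [← Real.rpow_one H]
      exact Real.rpow_le_rpow_of_exponent_le hH (by linarith)
    have hsq : |(⌊H⌋₊ : ℝ) ^ 2 - H ^ 2| ≤ 2 * H := by
      rw [abs_le]
      constructor <;> nlinarith
    rw [← mul_sub, abs_mul, abs_of_pos hσ]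
    nlinarith
  linarith [abs_sub_le (squarefreePairCount H : ℝ) (sigmaConst * (⌊H⌋₊ : ℝ) ^ 2) (sigmaConst * H ^ 2)]

/-- A finite set of values `x ^ 2 + y ^ 2 + 1` would keep the number of pairs bounded, whereas it
grows like `σ H ^ 2` with `σ > 0`. -/
theorem infinite_squarefree_values : {n : ℕ | ∃ x y : ℕ, 0 < x ∧ 0 < y ∧ n = x ^ 2 + y ^ 2 + 1 ∧
    Squarefree n ∧ Squarefree (n + 1)}.Infinite := by
  intro hfin
  obtain ⟨M, hM⟩ := hfin.bddAbove
  have hbound : ∀ H : ℝ, squarefreePairCount H ≤ (Icc 1 M ×ˢ Icc 1 M).card := fun H => by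
    refine card_le_card fun v hv => ?_
    obtain ⟨hv1, h1, h2⟩ := mem_filter.1 hv
    simp only [mem_product, mem_Icc] at hv1
    have := hM ⟨v.1, v.2, by omega, by omega, rfl, h1, h2⟩
    simp only [mem_product, mem_Icc]
    exact ⟨⟨hv1.1.1, by nlinarith⟩, hv1.2.1, by nlinarith⟩
  have h1 : (fun H : ℝ => (squarefreePairCount H : ℝ)) =o[Filter.atTop] fun H : ℝ => H ^ 2 := by
    have hO : (fun H : ℝ => (squarefreePairCount H : ℝ)) =O[Filter.atTop] fun _ => (1 : ℝ) :=
      Asymptotics.IsBigO.of_bound ((Icc 1 M ×ˢ Icc 1 M).card : ℝ) (.of_forall fun H => by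
        simpa using (Nat.cast_le (α := ℝ)).2 (hbound H))
    exact hO.trans_isLittleO ((Asymptotics.isLittleO_one_left_iff ℝ).2
      (tendsto_norm_atTop_atTop.comp (Filter.tendsto_pow_atTop two_ne_zero)))
  have h2 : (fun H : ℝ => (squarefreePairCount H : ℝ) - sigmaConst * H ^ 2) =o[Filter.atTop]
      fun H : ℝ => H ^ 2 := by
    refine (squarefreePairCount_isBigO (ε := 1 / 4) (by norm_num) (by norm_num)).trans_isLittleO ?_
    refine Asymptotics.isLittleO_of_tendsto' ?_ ?_
    · filter_upwards [Filter.eventually_gt_atTop 0] with H hH h0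
      exact absurd h0 (by positivity)
    · refine (tendsto_rpow_neg_atTop (by norm_num : (0 : ℝ) < 1 / 4)).congr' ?_
      filter_upwards [Filter.eventually_gt_atTop 0] with H hH
      rw [← Real.rpow_two, ← Real.rpow_sub hH]
      norm_num
  have h3 : (fun H : ℝ => sigmaConst * H ^ 2) =o[Filter.atTop] fun H : ℝ => H ^ 2 := by
    simpa using h1.sub h2
  rw [Asymptotics.isLittleO_const_mul_left_iff sigmaConst_pos.ne'] at h3
  refine Asymptotics.isLittleO_irrefl ?_ h3
  exact ((Filter.eventually_gt_atTop (0 : ℝ)).mono fun H hH => (pow_pos hH 2).ne').frequently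

theorem theorem1 :
    Multipliable sigmaFactor ∧
    (∀ ε : ℝ, 0 < ε →
      Asymptotics.IsBigO Filter.atTop
        (fun H : ℝ => (squarefreePairCount H : ℝ) - sigmaConst * H ^ 2)
        (fun H : ℝ => H ^ ((8 : ℝ) / 5 + ε))) ∧
    {n : ℕ | ∃ x y : ℕ, 0 < x ∧ 0 < y ∧ n = x ^ 2 + y ^ 2 + 1 ∧
      Squarefree n ∧ Squarefree (n + 1)}.Infinite := by
  refine ⟨hasProd_sigmaFactor.multipliable, fun ε hε => ?_, infinite_squarefree_values⟩
  refine (squarefreePairCount_isBigO (lt_min hε one_half_pos) (min_le_right ε _)).trans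
    (Asymptotics.IsBigO.of_bound 1 ?_)
  filter_upwards [Filter.eventually_ge_atTop 1] with H hH
  rw [one_mul, Real.norm_eq_abs, Real.norm_eq_abs, abs_of_nonneg (by positivity),
    abs_of_nonneg (by positivity)]
  exact Real.rpow_le_rpow_of_exponent_le hH (by linarith [min_le_left ε (1 / 2)])
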